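/- Let $(X_i,Y_i)_{i\ge1}$ be i.i.d. random vectors in $\mathbb R^2$ with continuous marginal distribution functions $F_X,F_Y$, and let $C(u,v)=\Pr(F_X(X_1)\le u,\,F_Y(Y_1)\le v)$ be their copula. For $p,q\in(0,1)$ put $$v(q\mid p)=\inf\{v\in[0,1]: C(p,v)/p\ge q\}.$$ Let $\mathcal S_1=\{(w_1,w_2): w_1>0,\ w_2>0,\ w_1+w_2=2\}$; integrals over $\mathcal S_1$ are one-dimensional, $\int_{\mathcal S_1} f:=\int_0^2 f(w,2-w)\,dw$. Let $\Theta\subset\mathbb R^d$ and let $b(w_1,w_2;\theta)$, $w_1,w_2>0$, $\theta\in\Theta$, be a parametric model for the lower tail dependence function; in particular, like every tail dependence function, each $b(\cdot;\theta)$ is positively homogeneous of degree one: $b(tw_1,tw_2;\theta)=t\,b(w_1,w_2;\theta)$ for $t>0$. Assume: (A1) $\Theta$ is compact. (A2) (Correct specification with tail order $\kappa=1$.) There is $\theta_0\in\Theta$ such that $$\sup_{(w_1,w_2)\in\mathcal S_1}\Bigl|\frac{C(uw_1,uw_2)}{u}-b(w_1,w_2;\theta_0)\Bigr|\to0\qquad(u\downarrow0).$$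 (A3) $(w_1,w_2,\theta)\mapsto b(w_1,w_2;\theta)$ is continuous on $\mathcal S_1\times\Theta$. (A4) For every $\theta\in\Theta$, $H(r;\theta):=b(1,r;\theta)$, $r>0$, is a proper, absolutely continuous distribution function on $(0,\infty)$. Write $H^{-1}(q;\theta)=\inf\{r>0: H(r;\theta)\ge q\}$. (A5) For every $\varepsilon>0$, $$\inf_{\theta\in\Theta:\ \|\theta-\theta_0\|\ge\varepsilon}\ \int_{\mathcal S_1}|b(\cdot;\theta)-b(\cdot;\theta_0)|>0$$ (with $\inf\emptyset=+\infty$). Let $k_n\to\infty$ with $p_n:=k_n/n\to0$. With $U_{i,n}=\frac1n\sum_{j=1}^n\mathbf 1\{X_j\le X_i\}$, $V_{i,n}=\frac1n\sum_{j=1}^n\mathbf 1\{Y_j\le Y_i\}$ and $\widehat C_n(u,v)=\frac1n\sum_{i=1}^n\mathbf 1\{U_{i,n}\le u,\,V_{i,n}\le v\}$, let $\widehat b_{k_n,n}(w_1,w_2)=\widehat C_n(p_nw_1,p_nw_2)/p_n$ be the empirical tail dependence function, and let $\hat\theta_n\in\Theta$ be any minimizer over $\Theta$ of $$Q_{k_n,n}(\theta)=\int_{\mathcal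 S_1}\bigl|\widehat b_{k_n,n}(w_1,w_2)-b(w_1,w_2;\theta)\bigr|.$$ Then, as $n\to\infty$, $$\hat\theta_n\xrightarrow{P}\theta_0,$$ and for every fixed $q\in(0,1)$ the plug-in estimator $\hat v_n(q\mid p_n)=H^{-1}(q;\hat\theta_n)\,p_n$ satisfies $$\frac{\hat v_n(q\mid p_n)}{v(q\mid p_n)}\xrightarrow{P}1 .$$ -/

import Mathlib

open MeasureTheory ProbabilityTheory Filter Topology

namespace CoVaR

noncomputable section

/-- The copula of a bivariate law `μ` with continuous margins: the joint distribution function of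
`(F_X(X), F_Y(Y))` for `(X, Y)` of law `μ`. -/
def copula (μ : Measure (ℝ × ℝ)) (u v : ℝ) : ℝ :=
  μ.real {z | cdf (μ.map Prod.fst) z.1 ≤ u ∧ cdf (μ.map Prod.snd) z.2 ≤ v}

/-- The copula-adjusted probability level
`v(q ∣ p; C) = inf {v ∈ [0,1] : C(p, v) / p ≥ q}`. -/
def adjustedLevel (C : ℝ → ℝ → ℝ) (q p : ℝ) : ℝ :=
  sInf {v : ℝ | v ∈ Set.Icc (0 : ℝ) 1 ∧ q ≤ C p v / p}

/-- The open segment `S₁ = {(w₁, w₂) : w₁ > 0, w₂ > 0, w₁ + w₂ = 2}`. -/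
def segmentS1 : Set (ℝ × ℝ) := {w | 0 < w.1 ∧ 0 < w.2 ∧ w.1 + w.2 = 2}

/-- The pseudo-observation `n⁻¹ ∑_{j < n} 1{x_j ≤ x_i}`. -/
def pseudoObs (x : ℕ → ℝ) (n i : ℕ) : ℝ :=
  ((Finset.range n).filter (fun j => x j ≤ x i)).card / (n : ℝ)

/-- The rank-based empirical copula
`Ĉ_n(u, v) = n⁻¹ ∑_{i < n} 1{U_{i,n} ≤ u, V_{i,n} ≤ v}`. -/
def empiricalCopula (x y : ℕ → ℝ) (n : ℕ) (u v : ℝ) : ℝ :=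
  ((Finset.range n).filter (fun i => pseudoObs x n i ≤ u ∧ pseudoObs y n i ≤ v)).card / (n : ℝ)

/-- The empirical tail dependence function `Ĉ_n(p w₁, p w₂) / p`, to be used with
`p = k_n / n`. -/
def empiricalTailDep (x y : ℕ → ℝ) (n : ℕ) (p w₁ w₂ : ℝ) : ℝ :=
  empiricalCopula x y n (p * w₁) (p * w₂) / p

/-- The `L¹` distance on `S₁` between two functions of `(w₁, w₂)`. The segment `S₁` is
parametrized by its first coordinate, `w ↦ (w, 2 - w)` with `0 < w < 2`. -/
def distS1 (f g : ℝ → ℝ → ℝ) : ℝ :=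
  ∫ w in Set.Ioo (0 : ℝ) 2, |f w (2 - w) - g w (2 - w)|

/-- `f` is positively homogeneous of degree one on the open quadrant, as the tail dependence
function `lim_{u ↓ 0} C(u w₁, u w₂) / u` of any copula is. -/
def IsHomogeneousOne (f : ℝ → ℝ → ℝ) : Prop :=
  ∀ t w₁ w₂ : ℝ, 0 < t → 0 < w₁ → 0 < w₂ → f (t * w₁) (t * w₂) = t * f w₁ w₂

/-- `H` is, on `(0, ∞)`, the distribution function of a probability measure which is carried by
`(0, ∞)` and absolutely continuous with respect to Lebesgue measure. -/
def IsACDistributionFunction (H : ℝ → ℝ) : Prop :=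
  ∃ ν : Measure ℝ, IsProbabilityMeasure ν ∧ ν (Set.Iic 0) = 0 ∧ ν ≪ volume ∧
    ∀ r : ℝ, 0 < r → H r = ν.real (Set.Iic r)

/-- The (generalized) inverse `H⁻¹(q) = inf {r > 0 : H(r) ≥ q}` of a function on `(0, ∞)`. -/
def quantileInv (H : ℝ → ℝ) (q : ℝ) : ℝ :=
  sInf {r : ℝ | 0 < r ∧ q ≤ H r}

end

end CoVaR

namespace CoVaR

/-! Write β for the true tail dependence function. By homogeneity the expansion on the segment gives
C(ua, uc)/u → β(a, c) on the whole open quadrant, so β inherits from copulas monotonicity, the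
Lipschitz bound, the bounds by a and c, and the 2-increasing property
(`isTailDependence_of_tendsto`).

Consistency of the estimator: counts of sample points in shrinking quadrants concentrate at scale
k_n by Chebyshev (`withHighProb_card_div`). Ranks are sandwiched between such counts at slightly
perturbed levels, which gives pointwise consistency of the empirical tail dependence function; a
grid argument makes it uniform on the segment, hence L¹ (`withHighProb_distS1`). Minimality and the
triangle inequality bound the L¹ distance from the fitted model to β by twice the empirical error,
and identifiability concludes.

The plug-in ratio: both v(q∣p)/p and the model quantile near θ₀ tend to the quantile of β(1, ·).
This requires β(1, ·) to exceed q immediately to the right of that quantile. It does: homogeneity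
and the 2-increasing property propagate a flat stretch geometrically to infinity, so flatness occurs
only at the limit value 1 (`one_le_of_flat`). -/

/-- The events `A n` hold with (outer) probability tending to one. -/
def WithHighProb {Ω : Type*} [MeasurableSpace Ω] (P : Measure Ω) (A : ℕ → Ω → Prop) : Prop :=
  Tendsto (fun n => P {ω | ¬ A n ω}) atTop (𝓝 0)

/-! ### Calculus of events with probability tending to one -/

namespace WithHighProb

variable {Ω : Type*} [MeasurableSpace Ω] {P : Measure Ω} {A B : ℕ → Ω → Prop}

theorem mono (hA : WithHighProb P A) (h : ∀ᶠ n in atTop, ∀ ω, A n ω → B n ω) :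
    WithHighProb P B := by
  refine tendsto_of_tendsto_of_tendsto_of_le_of_le' tendsto_const_nhds hA
    (Eventually.of_forall fun n => zero_le) ?_
  filter_upwards [h] with n hn
  exact measure_mono fun ω hω hAω => hω (hn ω hAω)

theorem and (hA : WithHighProb P A) (hB : WithHighProb P B) :
    WithHighProb P (fun n ω => A n ω ∧ B n ω) := by
  have h : Tendsto (fun n => P {ω | ¬ A n ω} + P {ω | ¬ B n ω}) atTop (𝓝 0) := by
    simpa using Tendsto.add hA hB
  refine tendsto_of_tendsto_of_tendsto_of_le_of_le tendsto_const_nhds h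
    (fun n => zero_le) fun n => ?_
  refine (measure_mono ?_).trans (measure_union_le _ _)
  intro ω hω
  by_cases hAω : A n ω
  · exact Or.inr fun hBω => hω ⟨hAω, hBω⟩
  · exact Or.inl hAω

theorem of_ae (h : ∀ n, ∀ᵐ ω ∂P, A n ω) : WithHighProb P A := by
  have h0 : (fun n => P {ω | ¬ A n ω}) = fun _ => 0 := funext fun n => ae_iff.1 (h n)
  rw [WithHighProb, h0]
  exact tendsto_const_nhds

theorem finset_forall {ι : Type*} (s : Finset ι) {A : ι → ℕ → Ω → Prop}
    (h : ∀ i ∈ s, WithHighProb P (A i)) : WithHighProb P (fun n ω => ∀ i ∈ s, A i n ω) := by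
  classical
  induction s using Finset.induction_on with
  | empty => exact of_ae fun n => by simp
  | insert a s ha ih =>
    refine ((h a (by simp)).and (ih fun i hi => h i (by simp [hi]))).mono
      (Eventually.of_forall fun n ω hω => ?_)
    simpa using hω

end WithHighProb

theorem tendstoInMeasure_iff_withHighProb {Ω E : Type*} [MeasurableSpace Ω] {P : Measure Ω}
    [SeminormedAddCommGroup E] {f : ℕ → Ω → E} {g : Ω → E} :
    TendstoInMeasure P f atTop g ↔
      ∀ ε > 0, WithHighProb P (fun n ω => ‖f n ω - g ω‖ < ε) := by
  simp only [tendstoInMeasure_iff_norm, WithHighProb, not_lt, gt_iff_lt]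

/-! ### Weak law at the intermediate rate and the probability integral transform -/

open Classical in
/-- A weak law of large numbers for the number of visits of an i.i.d. sample to small sets `A n`,
at the intermediate rate `k n`. -/
theorem withHighProb_card_div {Ω E : Type*} [MeasurableSpace Ω] [MeasurableSpace E]
    {P : Measure Ω} [IsProbabilityMeasure P] {μ : Measure E} {Z : ℕ → Ω → E}
    (hlaw : ∀ i, HasLaw (Z i) μ P) (hindep : iIndepFun Z P)
    {k : ℕ → ℝ} (hk : Tendsto k atTop atTop) {A : ℕ → Set E} (hA : ∀ n, MeasurableSet (A n))
    {β : ℝ} (hβ : Tendsto (fun n : ℕ => μ.real (A n) / (k n / n)) atTop (𝓝 β))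
    {ε : ℝ} (hε : 0 < ε) :
    WithHighProb P (fun n ω =>
      |((Finset.range n).filter (fun i => Z i ω ∈ A n)).card / k n - β| < ε) := by
  set f : ℕ → E → ℝ := fun n => (A n).indicator 1 with hf
  have hfm : ∀ n, Measurable (f n) := fun n => measurable_one.indicator (hA n)
  have hfZ : ∀ n i, AEMeasurable (fun ω => f n (Z i ω)) P := fun n i =>
    (hfm n).comp_aemeasurable (hlaw i).aemeasurable
  have hfb : ∀ n z, ‖f n z‖ ≤ 1 := by
    intro n z
    by_cases hz : z ∈ A n <;> simp [hf, hz]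
  have hmem : ∀ n i, MemLp (fun ω => f n (Z i ω)) 2 P := fun n i =>
    MemLp.of_bound (hfZ n i).aestronglyMeasurable 1 (Eventually.of_forall fun ω => hfb n _)
  have hint : ∀ n i, ∫ ω, f n (Z i ω) ∂P = μ.real (A n) := by
    intro n i
    have h1 : ∫ ω, f n (Z i ω) ∂P = ∫ z, f n z ∂μ := by
      rw [← (hlaw i).map_eq, integral_map (hlaw i).aemeasurable]
      exact (hfm n).aestronglyMeasurable
    rw [h1, hf, integral_indicator_one (hA n)]
  set S : ℕ → Ω → ℝ := fun n => ∑ i ∈ Finset.range n, fun ω => f n (Z i ω) with hS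
  have hSmem : ∀ n, MemLp (S n) 2 P := fun n => memLp_finsetSum' _ fun i _ => hmem n i
  have hScard : ∀ n ω, S n ω = ((Finset.range n).filter (fun i => Z i ω ∈ A n)).card := by
    intro n ω
    simp [hS, hf, Set.indicator_apply]
  have hSint : ∀ n, ∫ ω, S n ω ∂P = n * μ.real (A n) := by
    intro n
    simp only [hS, Finset.sum_apply]
    rw [integral_finsetSum _ fun i _ => (hmem n i).integrable (by norm_num)]
    simp [hint]
  -- An indicator has variance at most its mean, so the variance of the count is O(k n), and
  -- Chebyshev at scale k n leaves a bound O(1 / k n).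
  have hSvar : ∀ n, variance (S n) P ≤ n * μ.real (A n) := by
    intro n
    rw [hS, IndepFun.variance_sum (fun i _ => hmem n i)]
    · calc ∑ i ∈ Finset.range n, variance (fun ω => f n (Z i ω)) P
          ≤ ∑ i ∈ Finset.range n, μ.real (A n) := by
            refine Finset.sum_le_sum fun i _ => ?_
            refine (variance_le_expectation_sq (hfZ n i).aestronglyMeasurable).trans_eq ?_
            rw [← hint n i]
            congr 1
            ext ω
            by_cases hz : Z i ω ∈ A n <;> simp [hf, hz]
        _ = n * μ.real (A n) := by simp
    · intro i _ j _ hij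
      exact (hindep.indepFun hij).comp (hfm n) (hfm n)
  have hcheb : ∀ᶠ n in atTop, P {ω | k n * (ε / 2) ≤ |S n ω - n * μ.real (A n)|} ≤
      ENNReal.ofReal (μ.real (A n) / (k n / n) * (k n)⁻¹ * (4 / ε ^ 2)) := by
    filter_upwards [hk.eventually_gt_atTop 0, eventually_gt_atTop 0] with n hkn hn
    have hn' : (0 : ℝ) < n := by exact_mod_cast hn
    have hc := meas_ge_le_variance_div_sq (hSmem n) (c := k n * (ε / 2)) (by positivity)
    rw [hSint] at hc
    refine hc.trans (ENNReal.ofReal_le_ofReal ?_)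
    calc variance (S n) P / (k n * (ε / 2)) ^ 2
        ≤ n * μ.real (A n) / (k n * (ε / 2)) ^ 2 := by gcongr; exact hSvar n
      _ = _ := by field_simp; norm_num
  have hlim : Tendsto (fun n : ℕ =>
      ENNReal.ofReal (μ.real (A n) / (k n / n) * (k n)⁻¹ * (4 / ε ^ 2))) atTop (𝓝 0) := by
    have := ((hβ.mul (tendsto_inv_atTop_zero.comp hk)).mul_const (4 / ε ^ 2))
    simpa using ENNReal.tendsto_ofReal this
  have hwhp : WithHighProb P (fun n ω => |S n ω - n * μ.real (A n)| < k n * (ε / 2)) := by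
    simp only [WithHighProb, not_lt]
    exact tendsto_of_tendsto_of_tendsto_of_le_of_le' tendsto_const_nhds hlim
      (Eventually.of_forall fun n => zero_le) hcheb
  refine hwhp.mono ?_
  have hβ' := (Metric.tendsto_nhds.1 hβ) (ε / 2) (by positivity)
  filter_upwards [hk.eventually_gt_atTop 0, eventually_gt_atTop 0, hβ'] with n hkn hn hb ω hω
  have hn' : (0 : ℝ) < n := by exact_mod_cast hn
  rw [← hScard]
  have h1 : |S n ω / k n - μ.real (A n) / (k n / n)| < ε / 2 := by
    have : S n ω / k n - μ.real (A n) / (k n / n) = (S n ω - n * μ.real (A n)) / k n := by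
      field_simp
    rw [this, abs_div, abs_of_pos hkn, div_lt_iff₀ hkn]
    linarith
  rw [Real.dist_eq] at hb
  calc |S n ω / k n - β| ≤ |S n ω / k n - μ.real (A n) / (k n / n)|
        + |μ.real (A n) / (k n / n) - β| := abs_sub_le _ _ _
    _ < ε := by linarith

/-- The probability integral transform. -/
theorem measureReal_cdf_le (ν : Measure ℝ) [IsProbabilityMeasure ν] (hc : Continuous (cdf ν))
    {u : ℝ} (hu0 : 0 < u) (hu1 : u < 1) : ν.real {x | cdf ν x ≤ u} = u := by
  obtain ⟨x₀, hx₀⟩ : ∃ x, cdf ν x = u := by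
    obtain ⟨a, ha⟩ := ((tendsto_cdf_atBot ν).eventually_lt_const hu0).exists
    obtain ⟨c, hc'⟩ := ((tendsto_cdf_atTop ν).eventually_const_lt hu1).exists
    exact mem_range_of_exists_le_of_exists_ge hc ⟨a, ha.le⟩ ⟨c, hc'.le⟩
  obtain ⟨c, hc'⟩ := ((tendsto_cdf_atTop ν).eventually_const_lt hu1).exists
  set T : Set ℝ := {x | cdf ν x ≤ u} with hT
  have hbdd : BddAbove T := ⟨c, fun x hx => by
    by_contra! h
    exact absurd (monotone_cdf ν h.le) (not_le.2 (lt_of_le_of_lt hx hc'))⟩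
  have hne : T.Nonempty := ⟨x₀, hx₀.le⟩
  have hclosed : IsClosed T := isClosed_le hc continuous_const
  have hs : sSup T ∈ T := hclosed.csSup_mem hne hbdd
  have hTeq : T = Set.Iic (sSup T) := by
    ext x
    exact ⟨fun hx => le_csSup hbdd hx, fun hx => (monotone_cdf ν hx).trans hs⟩
  have hval : cdf ν (sSup T) = u :=
    le_antisymm hs (hx₀ ▸ monotone_cdf ν (le_csSup hbdd hx₀.le))
  rw [hTeq, ← cdf_eq_real, hval]

/-! ### Elementary inequalities for copulas -/

section Copula

variable (μ : Measure (ℝ × ℝ))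

theorem measurableSet_cdf_fst_le (u : ℝ) :
    MeasurableSet {z : ℝ × ℝ | cdf (μ.map Prod.fst) z.1 ≤ u} :=
  measurableSet_le ((monotone_cdf _).measurable.comp measurable_fst) measurable_const

theorem measurableSet_cdf_snd_le (v : ℝ) :
    MeasurableSet {z : ℝ × ℝ | cdf (μ.map Prod.snd) z.2 ≤ v} :=
  measurableSet_le ((monotone_cdf _).measurable.comp measurable_snd) measurable_const

theorem measurableSet_copula (u v : ℝ) : MeasurableSet
    {z : ℝ × ℝ | cdf (μ.map Prod.fst) z.1 ≤ u ∧ cdf (μ.map Prod.snd) z.2 ≤ v} :=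
  (measurableSet_cdf_fst_le μ u).inter (measurableSet_cdf_snd_le μ v)

theorem copula_nonneg (u v : ℝ) : 0 ≤ copula μ u v := measureReal_nonneg

variable [IsProbabilityMeasure μ]

theorem measureReal_cdf_fst_le (hX : Continuous (cdf (μ.map Prod.fst))) {u : ℝ} (hu0 : 0 < u)
    (hu1 : u < 1) : μ.real {z | cdf (μ.map Prod.fst) z.1 ≤ u} = u := by
  have : IsProbabilityMeasure (μ.map Prod.fst) :=
    Measure.isProbabilityMeasure_map measurable_fst.aemeasurable
  have h := measureReal_cdf_le (μ.map Prod.fst) hX hu0 hu1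
  rwa [map_measureReal_apply measurable_fst
    (measurableSet_le (monotone_cdf _).measurable measurable_const)] at h

theorem measureReal_cdf_snd_le (hY : Continuous (cdf (μ.map Prod.snd))) {v : ℝ} (hv0 : 0 < v)
    (hv1 : v < 1) : μ.real {z | cdf (μ.map Prod.snd) z.2 ≤ v} = v := by
  have : IsProbabilityMeasure (μ.map Prod.snd) :=
    Measure.isProbabilityMeasure_map measurable_snd.aemeasurable
  have h := measureReal_cdf_le (μ.map Prod.snd) hY hv0 hv1
  rwa [map_measureReal_apply measurable_snd
    (measurableSet_le (monotone_cdf _).measurable measurable_const)] at h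

theorem copula_mono {u u' v v' : ℝ} (hu : u ≤ u') (hv : v ≤ v') : copula μ u v ≤ copula μ u' v' :=
  measureReal_mono fun _ hz => ⟨hz.1.trans hu, hz.2.trans hv⟩

theorem copula_le_left (hX : Continuous (cdf (μ.map Prod.fst))) {u : ℝ} (hu0 : 0 < u)
    (hu1 : u < 1) (v : ℝ) : copula μ u v ≤ u :=
  (measureReal_mono fun _ hz => hz.1).trans_eq (measureReal_cdf_fst_le μ hX hu0 hu1)

theorem copula_le_right (hY : Continuous (cdf (μ.map Prod.snd))) {v : ℝ} (hv0 : 0 < v)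
    (hv1 : v < 1) (u : ℝ) : copula μ u v ≤ v :=
  (measureReal_mono fun _ hz => hz.2).trans_eq (measureReal_cdf_snd_le μ hY hv0 hv1)

/-- The increment is the mass of part of a vertical strip, and the whole strip has mass u' - u by
the probability integral transform. -/
theorem copula_sub_le_left (hX : Continuous (cdf (μ.map Prod.fst))) {u u' : ℝ} (hu0 : 0 < u)
    (huu : u ≤ u') (hu1 : u' < 1) (v : ℝ) : copula μ u' v - copula μ u v ≤ u' - u := by
  have h1 := measureReal_cdf_fst_le μ hX hu0 (huu.trans_lt hu1)
  have h2 := measureReal_cdf_fst_le μ hX (hu0.trans_le huu) hu1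
  have hsub : {z : ℝ × ℝ | cdf (μ.map Prod.fst) z.1 ≤ u} ⊆
      {z | cdf (μ.map Prod.fst) z.1 ≤ u'} := fun z hz => le_trans hz huu
  have hsub' : {z : ℝ × ℝ | cdf (μ.map Prod.fst) z.1 ≤ u ∧ cdf (μ.map Prod.snd) z.2 ≤ v} ⊆
      {z | cdf (μ.map Prod.fst) z.1 ≤ u' ∧ cdf (μ.map Prod.snd) z.2 ≤ v} :=
    fun z hz => ⟨hz.1.trans huu, hz.2⟩
  have d1 := measureReal_sdiff (μ := μ) hsub (measurableSet_cdf_fst_le μ u)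
  have d2 := measureReal_sdiff (μ := μ) hsub' (measurableSet_copula μ u v)
  have hle : μ.real ({z : ℝ × ℝ | cdf (μ.map Prod.fst) z.1 ≤ u' ∧ cdf (μ.map Prod.snd) z.2 ≤ v} \
      {z | cdf (μ.map Prod.fst) z.1 ≤ u ∧ cdf (μ.map Prod.snd) z.2 ≤ v}) ≤
      μ.real ({z : ℝ × ℝ | cdf (μ.map Prod.fst) z.1 ≤ u'} \
        {z | cdf (μ.map Prod.fst) z.1 ≤ u}) :=
    measureReal_mono fun z hz => ⟨hz.1.1, fun h => hz.2 ⟨h, hz.1.2⟩⟩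
  rw [d1, d2, h1, h2] at hle
  unfold copula
  linarith

theorem copula_sub_le_right (hY : Continuous (cdf (μ.map Prod.snd))) {v v' : ℝ} (hv0 : 0 < v)
    (hvv : v ≤ v') (hv1 : v' < 1) (u : ℝ) : copula μ u v' - copula μ u v ≤ v' - v := by
  have h1 := measureReal_cdf_snd_le μ hY hv0 (hvv.trans_lt hv1)
  have h2 := measureReal_cdf_snd_le μ hY (hv0.trans_le hvv) hv1
  have hsub : {z : ℝ × ℝ | cdf (μ.map Prod.snd) z.2 ≤ v} ⊆
      {z | cdf (μ.map Prod.snd) z.2 ≤ v'} := fun z hz => le_trans hz hvv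
  have hsub' : {z : ℝ × ℝ | cdf (μ.map Prod.fst) z.1 ≤ u ∧ cdf (μ.map Prod.snd) z.2 ≤ v} ⊆
      {z | cdf (μ.map Prod.fst) z.1 ≤ u ∧ cdf (μ.map Prod.snd) z.2 ≤ v'} :=
    fun z hz => ⟨hz.1, hz.2.trans hvv⟩
  have d1 := measureReal_sdiff (μ := μ) hsub (measurableSet_cdf_snd_le μ v)
  have d2 := measureReal_sdiff (μ := μ) hsub' (measurableSet_copula μ u v)
  have hle : μ.real ({z : ℝ × ℝ | cdf (μ.map Prod.fst) z.1 ≤ u ∧ cdf (μ.map Prod.snd) z.2 ≤ v'} \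
      {z | cdf (μ.map Prod.fst) z.1 ≤ u ∧ cdf (μ.map Prod.snd) z.2 ≤ v}) ≤
      μ.real ({z : ℝ × ℝ | cdf (μ.map Prod.snd) z.2 ≤ v'} \
        {z | cdf (μ.map Prod.snd) z.2 ≤ v}) :=
    measureReal_mono fun z hz => ⟨hz.1.2, fun h => hz.2 ⟨hz.1.1, h⟩⟩
  rw [d1, d2, h1, h2] at hle
  unfold copula
  linarith

/-- A copula is 2-increasing. -/
theorem copula_sub_le_copula_sub {u u' v v' : ℝ} (hu : u ≤ u') (hv : v ≤ v') :
    copula μ u v' - copula μ u v ≤ copula μ u' v' - copula μ u' v := by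
  have hsub (a : ℝ) : {z : ℝ × ℝ | cdf (μ.map Prod.fst) z.1 ≤ a ∧ cdf (μ.map Prod.snd) z.2 ≤ v} ⊆
      {z | cdf (μ.map Prod.fst) z.1 ≤ a ∧ cdf (μ.map Prod.snd) z.2 ≤ v'} :=
    fun z hz => ⟨hz.1, hz.2.trans hv⟩
  have d1 := measureReal_sdiff (μ := μ) (hsub u) (measurableSet_copula μ u v)
  have d2 := measureReal_sdiff (μ := μ) (hsub u') (measurableSet_copula μ u' v)
  unfold copula
  rw [← d1, ← d2]
  exact measureReal_mono fun z hz =>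
    ⟨⟨hz.1.1.trans hu, hz.1.2⟩, fun h => hz.2 ⟨hz.1.1, h.2⟩⟩

end Copula

/-- The analytic properties of lower tail dependence functions on the open quadrant. -/
structure IsTailDependence (β : ℝ → ℝ → ℝ) : Prop where
  homogeneous : IsHomogeneousOne β
  nonneg : ∀ {a c : ℝ}, 0 < a → 0 < c → 0 ≤ β a c
  le_left : ∀ {a c : ℝ}, 0 < a → 0 < c → β a c ≤ a
  le_right : ∀ {a c : ℝ}, 0 < a → 0 < c → β a c ≤ c
  mono : ∀ {a a' c c' : ℝ}, 0 < a → 0 < c → a ≤ a' → c ≤ c' → β a c ≤ β a' c'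
  sub_le : ∀ {a a' c c' : ℝ}, 0 < a → 0 < c → a ≤ a' → c ≤ c' →
    β a' c' - β a c ≤ (a' - a) + (c' - c)
  two_increasing : ∀ {a a' c c' : ℝ}, 0 < a → 0 < c → a ≤ a' → c ≤ c' →
    β a c' - β a c ≤ β a' c' - β a' c

/-! ### The limit inherits the copula inequalities -/

section Limit

variable {μ : Measure (ℝ × ℝ)} {β : ℝ → ℝ → ℝ}

/-- A uniform tail expansion on the segment extends, by homogeneity, to a pointwise one on the
open quadrant. -/
theorem tendsto_copula_div (hhom : IsHomogeneousOne β)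
    (hexp : TendstoUniformlyOn
      (fun (u : ℝ) (w : ℝ × ℝ) => copula μ (u * w.1) (u * w.2) / u)
      (fun w => β w.1 w.2) (𝓝[>] 0) segmentS1) {a c : ℝ} (ha : 0 < a) (hc : 0 < c) :
    Tendsto (fun u => copula μ (u * a) (u * c) / u) (𝓝[>] 0) (𝓝 (β a c)) := by
  -- Dividing by t moves (a, c) onto the segment; t is absorbed into the scale u.
  set t := (a + c) / 2 with ht
  have ht0 : 0 < t := by positivity
  have hmem : (a / t, c / t) ∈ segmentS1 :=
    ⟨by positivity, by positivity, by simp only [ht]; field_simp⟩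
  have h1 := hexp.tendsto_at hmem
  have h2 : Tendsto (fun u : ℝ => u * t) (𝓝[>] 0) (𝓝[>] 0) := by
    refine tendsto_nhdsWithin_iff.2 ⟨?_, ?_⟩
    · have : Tendsto (fun u : ℝ => u * t) (𝓝 0) (𝓝 (0 * t)) := tendsto_id.mul_const t
      rw [zero_mul] at this
      exact this.mono_left nhdsWithin_le_nhds
    · filter_upwards [self_mem_nhdsWithin] with u hu
      exact mul_pos hu ht0
  have h3 := (h1.comp h2).const_mul t
  have h4 : t * β (a / t) (c / t) = β a c := by
    rw [← hhom t _ _ ht0 hmem.1 hmem.2.1, mul_div_cancel₀ _ ht0.ne', mul_div_cancel₀ _ ht0.ne']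
  simp only [h4] at h3
  refine h3.congr' ?_
  filter_upwards [self_mem_nhdsWithin] with u hu
  have hu' : (0 : ℝ) < u := hu
  have e1 : u * t * (a / t) = u * a := by field_simp
  have e2 : u * t * (c / t) = u * c := by field_simp
  simp only [Function.comp, e1, e2]
  field_simp

theorem eventually_mul_lt_one (a : ℝ) : ∀ᶠ u : ℝ in 𝓝[>] 0, u * a < 1 := by
  have : Tendsto (fun u : ℝ => u * a) (𝓝 0) (𝓝 (0 * a)) := tendsto_id.mul_const a
  rw [zero_mul] at this
  exact (this.mono_left nhdsWithin_le_nhds).eventually_lt_const one_pos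

/-- Each inequality holds for the copula at scale u and survives division by u and the limit. The
marginal bounds need levels below one, which holds for all small u. -/
theorem isTailDependence_of_tendsto [IsProbabilityMeasure μ]
    (hX : Continuous (cdf (μ.map Prod.fst))) (hY : Continuous (cdf (μ.map Prod.snd)))
    (hhom : IsHomogeneousOne β)
    (h : ∀ {a c : ℝ}, 0 < a → 0 < c →
      Tendsto (fun u => copula μ (u * a) (u * c) / u) (𝓝[>] 0) (𝓝 (β a c))) :
    IsTailDependence β where
  homogeneous := hhom
  nonneg ha hc := by
    refine ge_of_tendsto (h ha hc) ?_
    filter_upwards [self_mem_nhdsWithin] with u hu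
    exact div_nonneg (copula_nonneg μ _ _) (le_of_lt hu)
  le_left {a c} ha hc := by
    refine le_of_tendsto (h ha hc) ?_
    filter_upwards [self_mem_nhdsWithin, eventually_mul_lt_one a] with u hu hu1
    rw [div_le_iff₀ hu, mul_comm a]
    exact copula_le_left μ hX (mul_pos hu ha) hu1 _
  le_right {a c} ha hc := by
    refine le_of_tendsto (h ha hc) ?_
    filter_upwards [self_mem_nhdsWithin, eventually_mul_lt_one c] with u hu hu1
    rw [div_le_iff₀ hu, mul_comm c]
    exact copula_le_right μ hY (mul_pos hu hc) hu1 _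
  mono ha hc haa hcc := by
    refine le_of_tendsto_of_tendsto (h ha hc) (h (ha.trans_le haa) (hc.trans_le hcc)) ?_
    filter_upwards [self_mem_nhdsWithin] with u hu
    have hu' : (0 : ℝ) < u := hu
    have := copula_mono μ (mul_le_mul_of_nonneg_left haa hu'.le)
      (mul_le_mul_of_nonneg_left hcc hu'.le)
    gcongr
  sub_le {a a' c c'} ha hc haa hcc := by
    refine le_of_tendsto ((h (ha.trans_le haa) (hc.trans_le hcc)).sub (h ha hc)) ?_
    filter_upwards [self_mem_nhdsWithin, eventually_mul_lt_one a', eventually_mul_lt_one c']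
      with u hu hu1 hu2
    have hu' : (0 : ℝ) < u := hu
    have h1 := copula_sub_le_left μ hX (mul_pos hu ha) (mul_le_mul_of_nonneg_left haa hu'.le) hu1
      (u * c')
    have h2 := copula_sub_le_right μ hY (mul_pos hu hc) (mul_le_mul_of_nonneg_left hcc hu'.le) hu2
      (u * a)
    rw [← sub_div, div_le_iff₀ hu']
    linarith
  two_increasing ha hc haa hcc := by
    have ha' := ha.trans_le haa
    have hc' := hc.trans_le hcc
    refine le_of_tendsto_of_tendsto ((h ha hc').sub (h ha hc)) ((h ha' hc').sub (h ha' hc)) ?_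
    filter_upwards [self_mem_nhdsWithin] with u hu
    have hu' : (0 : ℝ) < u := hu
    have := copula_sub_le_copula_sub μ (mul_le_mul_of_nonneg_left haa hu'.le)
      (mul_le_mul_of_nonneg_left hcc hu'.le)
    simp only [← sub_div]
    gcongr

end Limit

/-! ### Deterministic comparison of ranks with counts -/

section Rank

variable {F : ℝ → ℝ} {x y : ℕ → ℝ} {n i : ℕ} {κ w s : ℝ}

/-- If F (x i) exceeded s, every x j counted at level s would lie below x i, so the rank of x i
would be at least a count already larger than κ * w. -/
theorem le_of_pseudoObs_le (hF : Monotone F) (hn : 0 < n)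
    (hN : κ * w < ((Finset.range n).filter (fun j => F (x j) ≤ s)).card)
    (h : pseudoObs x n i ≤ κ / n * w) : F (x i) ≤ s := by
  by_contra! hlt
  have hn' : (0 : ℝ) < n := by exact_mod_cast hn
  have hsub : (Finset.range n).filter (fun j => F (x j) ≤ s) ⊆
      (Finset.range n).filter (fun j => x j ≤ x i) := by
    refine Finset.monotone_filter_right _ fun j _ hj => ?_
    by_contra! hji
    exact absurd (hlt.trans_le (hF hji.le)) (not_lt.2 hj)
  have hcard : (((Finset.range n).filter (fun j => F (x j) ≤ s)).card : ℝ) ≤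
      ((Finset.range n).filter (fun j => x j ≤ x i)).card := by
    exact_mod_cast Finset.card_le_card hsub
  have e : κ / n * w = κ * w / n := by ring
  rw [pseudoObs, e, div_le_div_iff_of_pos_right hn'] at h
  linarith

/-- Everything ranked at or below x i is counted at level s, so the count bounds the rank. -/
theorem pseudoObs_le_of_le (hF : Monotone F) (hn : 0 < n)
    (hN : ((Finset.range n).filter (fun j => F (x j) ≤ s)).card ≤ κ * w)
    (h : F (x i) ≤ s) : pseudoObs x n i ≤ κ / n * w := by
  have hn' : (0 : ℝ) < n := by exact_mod_cast hn
  have hsub : (Finset.range n).filter (fun j => x j ≤ x i) ⊆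
      (Finset.range n).filter (fun j => F (x j) ≤ s) :=
    Finset.monotone_filter_right _ fun j _ hj => (hF hj).trans h
  have hcard : (((Finset.range n).filter (fun j => x j ≤ x i)).card : ℝ) ≤
      ((Finset.range n).filter (fun j => F (x j) ≤ s)).card := by
    exact_mod_cast Finset.card_le_card hsub
  have e : κ / n * w = κ * w / n := by ring
  rw [pseudoObs, e, div_le_div_iff_of_pos_right hn']
  linarith

theorem empiricalTailDep_eq (x y : ℕ → ℝ) (hn : 0 < n) (κ w₁ w₂ : ℝ) :
    empiricalTailDep x y n (κ / n) w₁ w₂ = ((Finset.range n).filter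
      (fun i => pseudoObs x n i ≤ κ / n * w₁ ∧ pseudoObs y n i ≤ κ / n * w₂)).card / κ := by
  have hn' : (0 : ℝ) < n := by exact_mod_cast hn
  rw [empiricalTailDep, empiricalCopula, div_div_div_cancel_right₀ hn'.ne']

theorem empiricalTailDep_nonneg (x y : ℕ → ℝ) (n : ℕ) {p : ℝ} (hp : 0 ≤ p) (w₁ w₂ : ℝ) :
    0 ≤ empiricalTailDep x y n p w₁ w₂ := by
  unfold empiricalTailDep empiricalCopula
  positivity

theorem empiricalTailDep_mono (x y : ℕ → ℝ) (n : ℕ) {p : ℝ} (hp : 0 ≤ p) {w₁ w₁' w₂ w₂' : ℝ}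
    (h₁ : w₁ ≤ w₁') (h₂ : w₂ ≤ w₂') :
    empiricalTailDep x y n p w₁ w₂ ≤ empiricalTailDep x y n p w₁' w₂' := by
  unfold empiricalTailDep empiricalCopula
  have : (Finset.range n).filter
        (fun i => pseudoObs x n i ≤ p * w₁ ∧ pseudoObs y n i ≤ p * w₂) ⊆
      (Finset.range n).filter
        (fun i => pseudoObs x n i ≤ p * w₁' ∧ pseudoObs y n i ≤ p * w₂') :=
    Finset.monotone_filter_right _ fun i _ hi =>
      ⟨hi.1.trans (by gcongr), hi.2.trans (by gcongr)⟩
  have hcard := Finset.card_le_card this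
  gcongr

end Rank

/-! ### Consistency of the empirical tail dependence function -/

section Consistency

variable {Ω : Type*} [MeasurableSpace Ω] {P : Measure Ω} [IsProbabilityMeasure P]
  {μ : Measure (ℝ × ℝ)} {X Y : ℕ → Ω → ℝ} {k : ℕ → ℝ}

theorem isProbabilityMeasure_of_hasLaw {E : Type*} [MeasurableSpace E] {ν : Measure E}
    {Z : Ω → E} (h : HasLaw Z ν P) : IsProbabilityMeasure ν :=
  h.isProbabilityMeasure_iff.1 inferInstance

theorem tendsto_div_nhdsGT_zero (hk : Tendsto k atTop atTop)
    (hkn : Tendsto (fun n : ℕ => k n / n) atTop (𝓝 0)) :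
    Tendsto (fun n : ℕ => k n / n) atTop (𝓝[>] 0) := by
  refine tendsto_nhdsWithin_iff.2 ⟨hkn, ?_⟩
  filter_upwards [hk.eventually_gt_atTop 0, eventually_gt_atTop 0] with n h1 h2
  exact div_pos h1 (by exact_mod_cast h2)

theorem withHighProb_card_fst (hlaw : ∀ i, HasLaw (fun ω => (X i ω, Y i ω)) μ P)
    (hindep : iIndepFun (fun i ω => (X i ω, Y i ω)) P)
    (hcontX : Continuous (cdf (μ.map Prod.fst))) (hk : Tendsto k atTop atTop)
    (hkn : Tendsto (fun n : ℕ => k n / n) atTop (𝓝 0)) {w ε : ℝ} (hw : 0 < w) (hε : 0 < ε) :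
    WithHighProb P (fun n ω => |((Finset.range n).filter
      (fun j => cdf (μ.map Prod.fst) (X j ω) ≤ k n / n * w)).card / k n - w| < ε) := by
  have := isProbabilityMeasure_of_hasLaw (hlaw 0)
  have hp := tendsto_div_nhdsGT_zero hk hkn
  have h := withHighProb_card_div hlaw hindep hk
    (A := fun n => {z | cdf (μ.map Prod.fst) z.1 ≤ k n / n * w})
    (fun n => measurableSet_cdf_fst_le μ _) (β := w) ?_ hε
  · refine h.mono (Eventually.of_forall fun n ω hω => ?_)
    convert hω
    exact Iff.rfl
  · refine tendsto_const_nhds.congr' ?_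
    filter_upwards [hp self_mem_nhdsWithin, hp (eventually_mul_lt_one w)] with n h0 h1
    have h0' : 0 < k n / n := h0
    rw [measureReal_cdf_fst_le μ hcontX (mul_pos h0' hw) h1, mul_div_cancel_left₀ _ h0'.ne']

theorem withHighProb_card_snd (hlaw : ∀ i, HasLaw (fun ω => (X i ω, Y i ω)) μ P)
    (hindep : iIndepFun (fun i ω => (X i ω, Y i ω)) P)
    (hcontY : Continuous (cdf (μ.map Prod.snd))) (hk : Tendsto k atTop atTop)
    (hkn : Tendsto (fun n : ℕ => k n / n) atTop (𝓝 0)) {w ε : ℝ} (hw : 0 < w) (hε : 0 < ε) :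
    WithHighProb P (fun n ω => |((Finset.range n).filter
      (fun j => cdf (μ.map Prod.snd) (Y j ω) ≤ k n / n * w)).card / k n - w| < ε) := by
  have := isProbabilityMeasure_of_hasLaw (hlaw 0)
  have hp := tendsto_div_nhdsGT_zero hk hkn
  have h := withHighProb_card_div hlaw hindep hk
    (A := fun n => {z | cdf (μ.map Prod.snd) z.2 ≤ k n / n * w})
    (fun n => measurableSet_cdf_snd_le μ _) (β := w) ?_ hε
  · refine h.mono (Eventually.of_forall fun n ω hω => ?_)
    convert hω
    exact Iff.rfl
  · refine tendsto_const_nhds.congr' ?_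
    filter_upwards [hp self_mem_nhdsWithin, hp (eventually_mul_lt_one w)] with n h0 h1
    have h0' : 0 < k n / n := h0
    rw [measureReal_cdf_snd_le μ hcontY (mul_pos h0' hw) h1, mul_div_cancel_left₀ _ h0'.ne']

theorem withHighProb_card_joint (hlaw : ∀ i, HasLaw (fun ω => (X i ω, Y i ω)) μ P)
    (hindep : iIndepFun (fun i ω => (X i ω, Y i ω)) P) (hk : Tendsto k atTop atTop)
    (hkn : Tendsto (fun n : ℕ => k n / n) atTop (𝓝 0)) {a c l : ℝ}
    (hl : Tendsto (fun u => copula μ (u * a) (u * c) / u) (𝓝[>] 0) (𝓝 l)) {ε : ℝ} (hε : 0 < ε) :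
    WithHighProb P (fun n ω => |((Finset.range n).filter
      (fun j => cdf (μ.map Prod.fst) (X j ω) ≤ k n / n * a ∧
        cdf (μ.map Prod.snd) (Y j ω) ≤ k n / n * c)).card / k n - l| < ε) := by
  have h := withHighProb_card_div hlaw hindep hk
    (A := fun n => {z | cdf (μ.map Prod.fst) z.1 ≤ k n / n * a ∧
      cdf (μ.map Prod.snd) z.2 ≤ k n / n * c})
    (fun n => measurableSet_copula μ _ _)
    (hl.comp (tendsto_div_nhdsGT_zero hk hkn)) hε
  refine h.mono (Eventually.of_forall fun n ω hω => ?_)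
  convert hω
  exact Iff.rfl

/-- Pointwise consistency of the empirical tail dependence function. -/
theorem withHighProb_empiricalTailDep (hlaw : ∀ i, HasLaw (fun ω => (X i ω, Y i ω)) μ P)
    (hindep : iIndepFun (fun i ω => (X i ω, Y i ω)) P)
    (hcontX : Continuous (cdf (μ.map Prod.fst))) (hcontY : Continuous (cdf (μ.map Prod.snd)))
    (hk : Tendsto k atTop atTop) (hkn : Tendsto (fun n : ℕ => k n / n) atTop (𝓝 0))
    {β : ℝ → ℝ → ℝ} (hβ : IsTailDependence β)
    (hl : ∀ {a c : ℝ}, 0 < a → 0 < c →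
      Tendsto (fun u => copula μ (u * a) (u * c) / u) (𝓝[>] 0) (𝓝 (β a c)))
    {w₁ w₂ ε : ℝ} (h₁ : 0 < w₁) (h₂ : 0 < w₂) (hε : 0 < ε) :
    WithHighProb P (fun n ω =>
      |empiricalTailDep (fun i => X i ω) (fun i => Y i ω) n (k n / n) w₁ w₂ - β w₁ w₂| < ε) := by
  -- Halving w₁ and w₂ keeps the perturbed corners positive. Moving both coordinates by δ changes β
  -- by at most 2δ ≤ ε / 2, leaving ε / 2 for the fluctuation of the joint counts.
  obtain ⟨δ, hδ, hδε, hδ₁, hδ₂⟩ : ∃ δ > 0, δ ≤ ε / 4 ∧ δ ≤ w₁ / 2 ∧ δ ≤ w₂ / 2 :=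
    ⟨min (ε / 4) (min (w₁ / 2) (w₂ / 2)), by positivity, min_le_left _ _,
      (min_le_right _ _).trans (min_le_left _ _), (min_le_right _ _).trans (min_le_right _ _)⟩
  have p₁ : 0 < w₁ - δ := by linarith
  have p₂ : 0 < w₂ - δ := by linarith
  have q₁ : 0 < w₁ + δ := by linarith
  have q₂ : 0 < w₂ + δ := by linarith
  have hε2 : 0 < ε / 2 := by positivity
  refine ((((withHighProb_card_fst hlaw hindep hcontX hk hkn p₁ hδ).and
    (withHighProb_card_fst hlaw hindep hcontX hk hkn q₁ hδ)).and
    ((withHighProb_card_snd hlaw hindep hcontY hk hkn p₂ hδ).and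
    (withHighProb_card_snd hlaw hindep hcontY hk hkn q₂ hδ))).and
    ((withHighProb_card_joint hlaw hindep hk hkn (hl p₁ p₂) hε2).and
    (withHighProb_card_joint hlaw hindep hk hkn (hl q₁ q₂) hε2))).mono ?_
  filter_upwards [hk.eventually_gt_atTop 0, eventually_gt_atTop 0]
    with n hkn0 hn ω ⟨⟨⟨hx, hx'⟩, ⟨hy, hy'⟩⟩, ⟨hj, hj'⟩⟩
  rw [empiricalTailDep_eq _ _ hn]
  rw [abs_lt] at *
  -- A count within δ of its target at level w ∓ δ falls on the correct side of w; this is what the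
  -- rank comparison needs.
  have low {N w : ℝ} (h : N / k n - (w - δ) < δ) : N ≤ k n * w := by
    have : N / k n ≤ w := by linarith
    rwa [div_le_iff₀ hkn0, mul_comm] at this
  have upp {N w : ℝ} (h : -δ < N / k n - (w + δ)) : k n * w < N := by
    have : w < N / k n := by linarith
    rwa [lt_div_iff₀ hkn0, mul_comm] at this
  have hsub : (Finset.range n).filter (fun i => pseudoObs (fun i => X i ω) n i ≤ k n / n * w₁ ∧
        pseudoObs (fun i => Y i ω) n i ≤ k n / n * w₂) ⊆
      (Finset.range n).filter (fun j => cdf (μ.map Prod.fst) (X j ω) ≤ k n / n * (w₁ + δ) ∧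
        cdf (μ.map Prod.snd) (Y j ω) ≤ k n / n * (w₂ + δ)) :=
    Finset.monotone_filter_right _ fun i _ hi =>
      ⟨le_of_pseudoObs_le (x := fun i => X i ω) (monotone_cdf _) hn (upp hx'.1) hi.1,
        le_of_pseudoObs_le (x := fun i => Y i ω) (monotone_cdf _) hn (upp hy'.1) hi.2⟩
  have hsub' : (Finset.range n).filter
        (fun j => cdf (μ.map Prod.fst) (X j ω) ≤ k n / n * (w₁ - δ) ∧
        cdf (μ.map Prod.snd) (Y j ω) ≤ k n / n * (w₂ - δ)) ⊆
      (Finset.range n).filter (fun i => pseudoObs (fun i => X i ω) n i ≤ k n / n * w₁ ∧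
        pseudoObs (fun i => Y i ω) n i ≤ k n / n * w₂) :=
    Finset.monotone_filter_right _ fun i _ hi =>
      ⟨pseudoObs_le_of_le (x := fun i => X i ω) (monotone_cdf _) hn (low hx.2) hi.1,
        pseudoObs_le_of_le (x := fun i => Y i ω) (monotone_cdf _) hn (low hy.2) hi.2⟩
  have hc : (_ : ℝ) / k n ≤ _ / k n :=
    div_le_div_of_nonneg_right (Nat.cast_le.2 (Finset.card_le_card hsub)) hkn0.le
  have hc' : (_ : ℝ) / k n ≤ _ / k n :=
    div_le_div_of_nonneg_right (Nat.cast_le.2 (Finset.card_le_card hsub')) hkn0.le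
  have b₁ := hβ.sub_le h₁ h₂ (le_add_of_nonneg_right hδ.le) (le_add_of_nonneg_right hδ.le)
  have b₂ := hβ.sub_le p₁ p₂ (sub_le_self w₁ hδ.le) (sub_le_self w₂ hδ.le)
  constructor <;> linarith [hj.1, hj'.2]

/-- On the segment, monotonicity upgrades closeness on a grid to uniform closeness. -/
theorem abs_sub_le_of_grid {β g : ℝ → ℝ → ℝ} (hβ : IsTailDependence β)
    (hg0 : ∀ a c, 0 ≤ g a c) (hg : ∀ {a a' c c'}, a ≤ a' → c ≤ c' → g a c ≤ g a' c')
    {M : ℕ} (hM : 0 < M) {ε : ℝ} (hε : 0 ≤ ε)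
    (hgrid : ∀ ij ∈ Finset.Icc 1 (2 * M) ×ˢ Finset.Icc 1 (2 * M),
      |g ((ij.1 : ℕ) / M) ((ij.2 : ℕ) / M) - β ((ij.1 : ℕ) / M) ((ij.2 : ℕ) / M)| < ε)
    {w : ℝ} (hw : w ∈ Set.Ioo (0 : ℝ) 2) :
    |g w (2 - w) - β w (2 - w)| ≤ ε + 2 / M := by
  have hM' : (0 : ℝ) < M := by exact_mod_cast hM
  have key : ∀ v ∈ Set.Ioo (0 : ℝ) 2, ∃ i ∈ Finset.Icc 1 (2 * M),
      v ≤ (i : ℝ) / M ∧ (i : ℝ) / M ≤ v + 1 / M := by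
    intro v hv
    have hpos : 0 < v * M := mul_pos hv.1 hM'
    refine ⟨⌈v * M⌉₊, Finset.mem_Icc.2 ⟨Nat.one_le_ceil_iff.2 hpos, Nat.ceil_le.2 ?_⟩, ?_, ?_⟩
    · push_cast
      exact mul_le_mul_of_nonneg_right hv.2.le hM'.le
    · rw [le_div_iff₀ hM']
      exact Nat.le_ceil _
    · have := (Nat.ceil_lt_add_one hpos.le).le
      rw [div_le_iff₀ hM', add_mul, one_div_mul_cancel hM'.ne']
      exact this
  have hw2 : 2 - w ∈ Set.Ioo (0 : ℝ) 2 := ⟨by linarith [hw.2], by linarith [hw.1]⟩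
  obtain ⟨i, hi, hi1, hi2⟩ := key w hw
  obtain ⟨j, hj, hj1, hj2⟩ := key (2 - w) hw2
  have h2M : (2 : ℝ) / M = 1 / M + 1 / M := by ring
  have hM1 : (0 : ℝ) < 1 / M := by positivity
  rw [abs_le]
  constructor
  -- The lower bound uses the grid point diagonally below, which leaves the positive grid when i or
  -- j is 1. In that case β ≤ 1 / M and nonnegativity of g suffices.
  · rcases Nat.lt_or_ge 1 i with hi' | hi'
    · rcases Nat.lt_or_ge 1 j with hj' | hj'
      · obtain ⟨a, rfl⟩ : ∃ a, i = a + 1 := ⟨i - 1, by omega⟩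
        obtain ⟨c, rfl⟩ : ∃ c, j = c + 1 := ⟨j - 1, by omega⟩
        have ha : 0 < a := by omega
        have hc : 0 < c := by omega
        have ha' : (0 : ℝ) < a / M := by positivity
        have hc' : (0 : ℝ) < c / M := by positivity
        push_cast [add_div] at hi1 hi2 hj1 hj2
        rw [Finset.mem_Icc] at hi hj
        have h := hgrid (a, c) (Finset.mem_product.2
          ⟨Finset.mem_Icc.2 ⟨ha, by omega⟩, Finset.mem_Icc.2 ⟨hc, by omega⟩⟩)
        have e1 : (a : ℝ) / M ≤ w := by linarith
        have e2 : (c : ℝ) / M ≤ 2 - w := by linarith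
        have m := hg e1 e2
        have l := hβ.sub_le ha' hc' e1 e2
        have h' := (abs_lt.1 h).1
        simp only at h'
        linarith
      · have hj1' : j = 1 := le_antisymm hj' (Finset.mem_Icc.1 hj).1
        subst hj1'
        rw [Nat.cast_one] at hj1
        have := hβ.le_right hw.1 hw2.1
        linarith [hg0 w (2 - w)]
    · have hi1' : i = 1 := le_antisymm hi' (Finset.mem_Icc.1 hi).1
      subst hi1'
      rw [Nat.cast_one] at hi1
      have := hβ.le_left hw.1 hw2.1
      linarith [hg0 w (2 - w)]
  · have h := (abs_lt.1 (hgrid (i, j) (Finset.mem_product.2 ⟨hi, hj⟩))).2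
    simp only at h
    have m := hg hi1 hj1
    have l := hβ.sub_le hw.1 hw2.1 hi1 hj1
    linarith

theorem distS1_le_of_abs_sub_le {f g : ℝ → ℝ → ℝ} {c : ℝ}
    (h : ∀ w ∈ Set.Ioo (0 : ℝ) 2, |f w (2 - w) - g w (2 - w)| ≤ c) : distS1 f g ≤ c * 2 := by
  have := norm_setIntegral_le_of_norm_le_const (μ := volume) (s := Set.Ioo (0 : ℝ) 2)
    (f := fun w => |f w (2 - w) - g w (2 - w)|) (C := c) (by simp)
    (fun w hw => by simpa using h w hw)
  refine (le_abs_self _).trans (this.trans_eq ?_)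
  simp

/-- `L¹` consistency of the empirical tail dependence function. -/
theorem withHighProb_distS1 (hlaw : ∀ i, HasLaw (fun ω => (X i ω, Y i ω)) μ P)
    (hindep : iIndepFun (fun i ω => (X i ω, Y i ω)) P)
    (hcontX : Continuous (cdf (μ.map Prod.fst))) (hcontY : Continuous (cdf (μ.map Prod.snd)))
    (hk : Tendsto k atTop atTop) (hkn : Tendsto (fun n : ℕ => k n / n) atTop (𝓝 0))
    {β : ℝ → ℝ → ℝ} (hβ : IsTailDependence β)
    (hl : ∀ {a c : ℝ}, 0 < a → 0 < c →
      Tendsto (fun u => copula μ (u * a) (u * c) / u) (𝓝[>] 0) (𝓝 (β a c)))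
    {ε : ℝ} (hε : 0 < ε) :
    WithHighProb P (fun n ω =>
      distS1 (empiricalTailDep (fun i => X i ω) (fun i => Y i ω) n (k n / n)) β < ε) := by
  -- This M makes the uniform error at most ε / 4, hence the integral over a segment of length 2 at
  -- most ε / 2.
  obtain ⟨M, hM⟩ := exists_nat_gt (16 / ε)
  have hM' : (0 : ℝ) < M := lt_trans (by positivity) hM
  have hM0 : 0 < M := by exact_mod_cast hM'
  have hMε : 2 / (M : ℝ) < ε / 8 := by
    rw [div_lt_iff₀ hM']
    rw [div_lt_iff₀ hε] at hM
    linarith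
  have hpos : ∀ i ∈ Finset.Icc 1 (2 * M), (0 : ℝ) < (i : ℝ) / M := fun i hi => by
    have : 0 < i := (Finset.mem_Icc.1 hi).1
    positivity
  refine (WithHighProb.finset_forall (Finset.Icc 1 (2 * M) ×ˢ Finset.Icc 1 (2 * M))
    fun ij hij => withHighProb_empiricalTailDep hlaw hindep hcontX hcontY hk hkn hβ hl
      (hpos ij.1 (Finset.mem_product.1 hij).1) (hpos ij.2 (Finset.mem_product.1 hij).2)
      (show 0 < ε / 8 by positivity)).mono ?_
  filter_upwards [tendsto_div_nhdsGT_zero hk hkn self_mem_nhdsWithin] with n hn ω hω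
  have hn' : 0 < k n / n := hn
  refine (distS1_le_of_abs_sub_le (c := ε / 8 + 2 / M) fun w hw => ?_).trans_lt (by linarith)
  exact abs_sub_le_of_grid hβ (empiricalTailDep_nonneg _ _ n hn'.le)
    (empiricalTailDep_mono _ _ n hn'.le) hM0 (by positivity) hω hw

end Consistency

/-! ### Integrability and the triangle inequality in L¹ -/

section Integrability

theorem integrableOn_empiricalTailDep (x y : ℕ → ℝ) (n : ℕ) (p : ℝ) :
    IntegrableOn (fun w => empiricalTailDep x y n p w (2 - w)) (Set.Ioo 0 2) := by
  have hmeas : Measurable (fun w => empiricalTailDep x y n p w (2 - w)) := by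
    unfold empiricalTailDep empiricalCopula
    simp only [Finset.card_filter, Nat.cast_sum, Nat.cast_ite, Nat.cast_one, Nat.cast_zero]
    refine ((Finset.measurable_sum _ fun i _ => Measurable.ite ?_ measurable_const
      measurable_const).div_const _).div_const _
    exact (measurableSet_le (g := fun w : ℝ => p * w) measurable_const (by fun_prop)).inter
      (measurableSet_le (g := fun w : ℝ => p * (2 - w)) measurable_const (by fun_prop))
  -- The bound also covers p = 0, where both sides vanish by the convention for division by zero.
  refine Measure.integrableOn_of_bounded (M := 1 / |p|) (by simp)
    hmeas.aestronglyMeasurable (Eventually.of_forall fun w => ?_)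
  unfold empiricalTailDep empiricalCopula
  rw [norm_div, Real.norm_eq_abs, Real.norm_eq_abs, abs_of_nonneg (by positivity)]
  gcongr
  refine div_le_one_of_le₀ ?_ (Nat.cast_nonneg n)
  exact_mod_cast (Finset.card_filter_le _ _).trans_eq (Finset.card_range n)

theorem distS1_triangle {f g h : ℝ → ℝ → ℝ}
    (hf : IntegrableOn (fun w => f w (2 - w)) (Set.Ioo 0 2))
    (hg : IntegrableOn (fun w => g w (2 - w)) (Set.Ioo 0 2))
    (hh : IntegrableOn (fun w => h w (2 - w)) (Set.Ioo 0 2)) :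
    distS1 f h ≤ distS1 g f + distS1 g h := by
  have h1 := (hg.sub hf).norm
  have h2 := (hg.sub hh).norm
  unfold distS1
  refine (integral_mono (hf.sub hh).norm (h1.add h2) fun w => ?_).trans_eq (integral_add h1 h2)
  simp only [Pi.add_apply, Pi.sub_apply, Real.norm_eq_abs]
  rw [abs_sub_comm (g w (2 - w)) (f w (2 - w))]
  exact abs_sub_le _ _ _

end Integrability

/-! ### Quantiles and absence of flat stretches -/

section DistributionFunction

variable {H : ℝ → ℝ}

theorem IsACDistributionFunction.mono (hH : IsACDistributionFunction H) {r r' : ℝ} (hr : 0 < r)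
    (hrr : r ≤ r') : H r ≤ H r' := by
  obtain ⟨ν, hν, -, -, h⟩ := hH
  rw [h r hr, h r' (hr.trans_le hrr)]
  exact measureReal_mono (Set.Iic_subset_Iic.2 hrr)

theorem IsACDistributionFunction.nonneg (hH : IsACDistributionFunction H) {r : ℝ} (hr : 0 < r) :
    0 ≤ H r := by
  obtain ⟨ν, hν, -, -, h⟩ := hH
  exact h r hr ▸ measureReal_nonneg

theorem IsACDistributionFunction.le_one (hH : IsACDistributionFunction H) {r : ℝ} (hr : 0 < r) :
    H r ≤ 1 := by
  obtain ⟨ν, hν, -, -, h⟩ := hH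
  exact h r hr ▸ measureReal_le_one

theorem IsACDistributionFunction.tendsto_atTop (hH : IsACDistributionFunction H) :
    Tendsto H atTop (𝓝 1) := by
  obtain ⟨ν, hν, -, -, h⟩ := hH
  refine (tendsto_cdf_atTop ν).congr' ?_
  filter_upwards [eventually_gt_atTop 0] with r hr
  rw [h r hr, cdf_eq_real]

theorem IsACDistributionFunction.exists_lt (hH : IsACDistributionFunction H) {q : ℝ}
    (hq : q < 1) : ∃ r, 0 < r ∧ q < H r :=
  ((eventually_gt_atTop 0).and (hH.tendsto_atTop.eventually_const_lt hq)).exists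

theorem bddBelow_quantileSet (q : ℝ) : BddBelow {r : ℝ | 0 < r ∧ q ≤ H r} :=
  ⟨0, fun _ hr => hr.1.le⟩

theorem lt_of_lt_quantileInv {q r : ℝ} (hr0 : 0 < r) (hr : r < quantileInv H q) : H r < q := by
  by_contra! h
  exact absurd (csInf_le (bddBelow_quantileSet q) ⟨hr0, h⟩) (not_le.2 hr)

theorem quantileInv_le {q r : ℝ} (hr0 : 0 < r) (h : q ≤ H r) : quantileInv H q ≤ r :=
  csInf_le (bddBelow_quantileSet q) ⟨hr0, h⟩

theorem IsACDistributionFunction.le_quantileInv (hH : IsACDistributionFunction H) {q r : ℝ}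
    (hq : q < 1) (h : H r < q) : r ≤ quantileInv H q := by
  -- Properness makes the quantile set nonempty; otherwise `sInf` would take its default value 0.
  obtain ⟨s, hs0, hs⟩ := hH.exists_lt hq
  refine le_csInf ⟨s, hs0, hs.le⟩ fun t ht => ?_
  by_contra! hlt
  exact absurd (ht.2.trans (hH.mono ht.1 hlt.le)) (not_le.2 h)

/-- By homogeneity and the 2-increasing property, `β 1 ·` has no flat stretch below its limit. -/
theorem IsTailDependence.one_le_of_flat {β : ℝ → ℝ → ℝ} (hβ : IsTailDependence β)
    (hlim : Tendsto (fun r => β 1 r) atTop (𝓝 1)) {s t : ℝ} (hs : 0 < s) (hst : s < t)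
    (hflat : β 1 t ≤ β 1 s) : 1 ≤ β 1 s := by
  set l := t / s with hl
  have hl1 : 1 < l := (one_lt_div hs).2 hst
  have hl0 : 0 < l := one_pos.trans hl1
  -- Compare increments over [r, l * r] at first coordinates l⁻¹ and 1: by homogeneity the former is
  -- l⁻¹ times the increment of β 1 over the next interval [l * r, l * (l * r)].
  have step : ∀ r, 0 < r → β 1 (l * r) ≤ β 1 r → β 1 (l * (l * r)) ≤ β 1 (l * r) := by
    intro r hr h
    have hlr : 0 < l * r := mul_pos hl0 hr
    have h1 : l⁻¹ ≤ 1 := inv_le_one_of_one_le₀ hl1.le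
    have h2 : r ≤ l * r := le_mul_of_one_le_left hr.le hl1.le
    have h3 := hβ.two_increasing (inv_pos.2 hl0) hr h1 h2
    have e (c : ℝ) (hc : 0 < c) : β l⁻¹ c = l⁻¹ * β 1 (l * c) := by
      rw [← hβ.homogeneous _ _ _ (inv_pos.2 hl0) one_pos (mul_pos hl0 hc), mul_one,
        inv_mul_cancel_left₀ hl0.ne']
    rw [e _ hlr, e _ hr, ← mul_sub] at h3
    have h4 : l⁻¹ * (β 1 (l * (l * r)) - β 1 (l * r)) ≤ 0 := h3.trans (sub_nonpos.2 h)
    exact sub_nonpos.1 (nonpos_of_mul_nonpos_right h4 (inv_pos.2 hl0))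
  have hpos : ∀ n : ℕ, 0 < l ^ n * s := fun n => by positivity
  have hdec : ∀ n : ℕ, β 1 (l ^ (n + 1) * s) ≤ β 1 (l ^ n * s) := by
    intro n
    induction n with
    | zero => simpa [hl, div_mul_cancel₀ _ hs.ne'] using hflat
    | succ n ih =>
      have e (m : ℕ) : l ^ (m + 1) * s = l * (l ^ m * s) := by ring
      rw [e (n + 1), e n]
      rw [e n] at ih
      exact step _ (hpos n) ih
  have hle : ∀ n : ℕ, β 1 (l ^ n * s) ≤ β 1 s := fun n => by
    simpa using antitone_nat_of_succ_le (f := fun n => β 1 (l ^ n * s)) hdec (Nat.zero_le n)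
  have htop : Tendsto (fun n : ℕ => l ^ n * s) atTop atTop :=
    (tendsto_pow_atTop_atTop_of_one_lt hl1).atTop_mul_const hs
  exact le_of_tendsto (hlim.comp htop) (Eventually.of_forall hle)

/-- Some t < r already has β 1 t ≥ q. If β 1 r ≤ q, then β 1 is flat on [t, r], which forces the
value 1 there and contradicts q < 1. -/
theorem IsTailDependence.lt_of_quantileInv_lt {β : ℝ → ℝ → ℝ} (hβ : IsTailDependence β)
    (hH : IsACDistributionFunction (β 1)) {q r : ℝ} (hq : q < 1)
    (hr : quantileInv (β 1) q < r) : q < β 1 r := by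
  obtain ⟨s, hs0, hs⟩ := hH.exists_lt hq
  obtain ⟨t, ⟨ht0, htq⟩, htr⟩ :=
    exists_lt_of_csInf_lt (s := {r | 0 < r ∧ q ≤ β 1 r}) ⟨s, hs0, hs.le⟩ hr
  by_contra! h
  have := hβ.one_le_of_flat hH.tendsto_atTop ht0 htr (h.trans htq)
  exact absurd ((this.trans (hH.mono ht0 htr.le)).trans h) (not_le.2 hq)

/-- Since β 1 t ≤ t, the quantile is at least q. -/
theorem IsTailDependence.quantileInv_pos {β : ℝ → ℝ → ℝ} (hβ : IsTailDependence β)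
    (hH : IsACDistributionFunction (β 1)) {q : ℝ} (hq : q ∈ Set.Ioo (0 : ℝ) 1) :
    0 < quantileInv (β 1) q := by
  obtain ⟨s, hs0, hs⟩ := hH.exists_lt hq.2
  exact hq.1.trans_le (le_csInf ⟨s, hs0, hs.le⟩ fun t ht => ht.2.trans (hβ.le_right one_pos ht.1))

/-- The quantile is continuous at a tail dependence function under pointwise convergence of
distribution functions. -/
theorem IsTailDependence.tendsto_quantileInv {β : ℝ → ℝ → ℝ} (hβ : IsTailDependence β)
    (hH : IsACDistributionFunction (β 1)) {ι : Type*} {L : Filter ι} {G : ι → ℝ → ℝ}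
    (hG : ∀ᶠ i in L, IsACDistributionFunction (G i))
    (hlim : ∀ r, 0 < r → Tendsto (fun i => G i r) L (𝓝 (β 1 r)))
    {q : ℝ} (hq : q ∈ Set.Ioo (0 : ℝ) 1) :
    Tendsto (fun i => quantileInv (G i) q) L (𝓝 (quantileInv (β 1) q)) := by
  have hpos := hβ.quantileInv_pos hH hq
  refine tendsto_order.2 ⟨fun a ha => ?_, fun a ha => ?_⟩
  -- The maximum with 0 keeps r positive, where pointwise convergence is available.
  · obtain ⟨r, har, hr⟩ := exists_between (max_lt ha hpos)
    have hr0 : 0 < r := (le_max_right _ _).trans_lt har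
    filter_upwards [hG, (hlim r hr0).eventually_lt_const (lt_of_lt_quantileInv hr0 hr)] with i hi h
    exact ((le_max_left _ _).trans_lt har).trans_le (hi.le_quantileInv hq.2 h)
  · obtain ⟨r, hr, hra⟩ := exists_between ha
    have hr0 : 0 < r := hpos.trans hr
    filter_upwards [(hlim r hr0).eventually_const_lt (hβ.lt_of_quantileInv_lt hH hq.2 hr)] with i h
    exact (quantileInv_le hr0 h.le).trans_lt hra

/-- With v = p * r, the rescaled level inverts r ↦ C(p, p * r) / p, which converges pointwise to β
1. The quantile argument is repeated, now with the constraint v ≤ 1, harmless for small p. -/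
theorem tendsto_adjustedLevel_div {μ : Measure (ℝ × ℝ)} [IsProbabilityMeasure μ]
    {β : ℝ → ℝ → ℝ} (hβ : IsTailDependence β) (hH : IsACDistributionFunction (β 1))
    (hl : ∀ {a c : ℝ}, 0 < a → 0 < c →
      Tendsto (fun u => copula μ (u * a) (u * c) / u) (𝓝[>] 0) (𝓝 (β a c)))
    {q : ℝ} (hq : q ∈ Set.Ioo (0 : ℝ) 1) :
    Tendsto (fun p => adjustedLevel (copula μ) q p / p) (𝓝[>] 0)
      (𝓝 (quantileInv (β 1) q)) := by
  have hpos := hβ.quantileInv_pos hH hq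
  have hl' : ∀ r, 0 < r → Tendsto (fun p => copula μ p (p * r) / p) (𝓝[>] 0) (𝓝 (β 1 r)) :=
    fun r hr => by simpa using hl one_pos hr
  have hmem : ∀ r, quantileInv (β 1) q < r → ∀ᶠ p in 𝓝[>] (0 : ℝ),
      p * r ∈ {v : ℝ | v ∈ Set.Icc (0 : ℝ) 1 ∧ q ≤ copula μ p v / p} := by
    intro r hr
    have hr0 : 0 < r := hpos.trans hr
    filter_upwards [self_mem_nhdsWithin, eventually_mul_lt_one r,
      (hl' r hr0).eventually_const_lt (hβ.lt_of_quantileInv_lt hH hq.2 hr)] with p hp h1 h2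
    exact ⟨⟨(mul_pos hp hr0).le, h1.le⟩, h2.le⟩
  refine tendsto_order.2 ⟨fun a ha => ?_, fun a ha => ?_⟩
  · obtain ⟨r, har, hr⟩ := exists_between (max_lt ha hpos)
    have hr0 : 0 < r := (le_max_right _ _).trans_lt har
    filter_upwards [self_mem_nhdsWithin, hmem _ (lt_add_one _),
      (hl' r hr0).eventually_lt_const (lt_of_lt_quantileInv hr0 hr)] with p hp hne h
    have hp' : (0 : ℝ) < p := hp
    refine ((le_max_left _ _).trans_lt har).trans_le ?_
    rw [le_div_iff₀ hp', mul_comm]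
    refine le_csInf ⟨_, hne⟩ fun v hv => ?_
    by_contra! hlt
    have := copula_mono μ (le_refl p) hlt.le
    have h3 : copula μ p v / p ≤ copula μ p (p * r) / p := by gcongr
    linarith [hv.2]
  · obtain ⟨r, hr, hra⟩ := exists_between ha
    filter_upwards [self_mem_nhdsWithin, hmem r hr] with p hp h
    have hp' : (0 : ℝ) < p := hp
    refine lt_of_le_of_lt ?_ hra
    rw [div_le_iff₀ hp', mul_comm]
    exact csInf_le ⟨0, fun v hv => hv.1.1⟩ h

end DistributionFunction

/-! ### Extending the model from the segment by homogeneity -/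

section Model

variable {E : Type*} [TopologicalSpace E] {Θ : Set E} {b : E → ℝ → ℝ → ℝ}

/-- Homogeneity gives b(w, 2 - w) = w H((2 - w) / w), which lies between 0 and 2 because H takes
values in [0, 1]. -/
theorem integrableOn_model
    (hcont : ContinuousOn (fun x : (ℝ × ℝ) × E => b x.2 x.1.1 x.1.2) (segmentS1 ×ˢ Θ))
    {θ : E} (hθ : θ ∈ Θ) (hhom : IsHomogeneousOne (b θ))
    (hH : IsACDistributionFunction (fun r => b θ 1 r)) :
    IntegrableOn (fun w => b θ w (2 - w)) (Set.Ioo 0 2) := by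
  have hc : ContinuousOn (fun w : ℝ => b θ w (2 - w)) (Set.Ioo 0 2) := by
    refine hcont.comp (f := fun w : ℝ => ((w, 2 - w), θ)) (by fun_prop) fun w hw => ?_
    exact ⟨⟨hw.1, sub_pos.2 hw.2, add_sub_cancel w 2⟩, hθ⟩
  refine Integrable.of_bound (hc.aestronglyMeasurable measurableSet_Ioo) 2 ?_
  filter_upwards [ae_restrict_mem measurableSet_Ioo] with w hw
  have hr : 0 < (2 - w) / w := div_pos (sub_pos.2 hw.2) hw.1
  have e : b θ w (2 - w) = w * b θ 1 ((2 - w) / w) := by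
    rw [← hhom w _ _ hw.1 one_pos hr, mul_one, mul_div_cancel₀ _ hw.1.ne']
  have h0 := hH.nonneg hr
  have h1 := hH.le_one hr
  rw [e, Real.norm_eq_abs, abs_of_nonneg (mul_nonneg hw.1.le h0)]
  calc w * b θ 1 ((2 - w) / w) ≤ w * 1 := mul_le_mul_of_nonneg_left h1 hw.1.le
    _ ≤ 2 := by linarith [hw.2]

theorem tendsto_model
    (hcont : ContinuousOn (fun x : (ℝ × ℝ) × E => b x.2 x.1.1 x.1.2) (segmentS1 ×ˢ Θ))
    (hhom : ∀ θ ∈ Θ, IsHomogeneousOne (b θ)) {θ₀ : E} (hθ₀ : θ₀ ∈ Θ) {a c : ℝ} (ha : 0 < a)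
    (hc : 0 < c) : Tendsto (fun θ => b θ a c) (𝓝[Θ] θ₀) (𝓝 (b θ₀ a c)) := by
  set t := (a + c) / 2 with ht
  have ht0 : 0 < t := by positivity
  have hmem : (a / t, c / t) ∈ segmentS1 :=
    ⟨by positivity, by positivity, by simp only [ht]; field_simp⟩
  have hcw : ContinuousOn (fun θ => b θ (a / t) (c / t)) Θ :=
    hcont.comp (f := fun θ => ((a / t, c / t), θ)) (by fun_prop) fun θ hθ => ⟨hmem, hθ⟩
  have e : ∀ θ ∈ Θ, t * b θ (a / t) (c / t) = b θ a c := fun θ hθ => by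
    rw [← hhom θ hθ t _ _ ht0 hmem.1 hmem.2.1, mul_div_cancel₀ _ ht0.ne',
      mul_div_cancel₀ _ ht0.ne']
  have h := (hcw θ₀ hθ₀).tendsto.const_mul t
  rw [e θ₀ hθ₀] at h
  refine h.congr' ?_
  filter_upwards [self_mem_nhdsWithin] with θ hθ
  exact e θ hθ

end Model

end CoVaR

theorem mainTheorem6
    {Ω : Type*} [MeasurableSpace Ω] (P : Measure Ω) [IsProbabilityMeasure P]
    -- an i.i.d. sample from a bivariate law with continuous margins
    (μ : Measure (ℝ × ℝ)) (X Y : ℕ → Ω → ℝ)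
    (hlaw : ∀ i, HasLaw (fun ω => (X i ω, Y i ω)) μ P)
    (hindep : iIndepFun (fun i ω => (X i ω, Y i ω)) P)
    (hcontX : Continuous (cdf (μ.map Prod.fst)))
    (hcontY : Continuous (cdf (μ.map Prod.snd)))
    -- the parametric model for the tail dependence function, with a compact parameter set
    {d : ℕ} (Θ : Set (EuclideanSpace ℝ (Fin d))) (hΘ : IsCompact Θ)
    (b : EuclideanSpace ℝ (Fin d) → ℝ → ℝ → ℝ)
    (hhom : ∀ θ ∈ Θ, CoVaR.IsHomogeneousOne (b θ))
    -- correct specification: uniform lower tail expansion of tail order one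
    (θ₀ : EuclideanSpace ℝ (Fin d)) (hθ₀ : θ₀ ∈ Θ)
    (hexp : TendstoUniformlyOn
      (fun (u : ℝ) (w : ℝ × ℝ) => CoVaR.copula μ (u * w.1) (u * w.2) / u)
      (fun w => b θ₀ w.1 w.2) (𝓝[>] 0) CoVaR.segmentS1)
    -- joint continuity
    (hcont : ContinuousOn
      (fun x : (ℝ × ℝ) × EuclideanSpace ℝ (Fin d) => b x.2 x.1.1 x.1.2)
      (CoVaR.segmentS1 ×ˢ Θ))
    -- `H(r; θ) = b(1, r; θ)` is a proper absolutely continuous distribution function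
    (hH : ∀ θ ∈ Θ, CoVaR.IsACDistributionFunction (fun r => b θ 1 r))
    -- identifiability in `L¹`: the infimum is positive (and `+∞` over the empty set)
    (hident : ∀ ε > 0, ∃ c > 0, ∀ θ ∈ Θ, ε ≤ ‖θ - θ₀‖ → c ≤ CoVaR.distS1 (b θ) (b θ₀))
    -- the intermediate sequence `k_n`; below `p_n = k_n / n`
    (k : ℕ → ℝ) (hk : Tendsto k atTop atTop)
    (hkn : Tendsto (fun n : ℕ => k n / n) atTop (𝓝 0))
    -- the minimum-distance estimator
    (θhat : ℕ → Ω → EuclideanSpace ℝ (Fin d))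
    (hθhat : ∀ n, ∀ᵐ ω ∂P, θhat n ω ∈ Θ ∧
      IsMinOn (fun θ => CoVaR.distS1
        (CoVaR.empiricalTailDep (fun i => X i ω) (fun i => Y i ω) n (k n / n)) (b θ))
        Θ (θhat n ω)) :
    TendstoInMeasure P θhat atTop (fun _ => θ₀) ∧
    ∀ q ∈ Set.Ioo (0 : ℝ) 1,
      TendstoInMeasure P
        (fun (n : ℕ) (ω : Ω) =>
          (CoVaR.quantileInv (fun r => b (θhat n ω) 1 r) q * (k n / n)) /
            CoVaR.adjustedLevel (CoVaR.copula μ) q (k n / n))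
        atTop (fun _ => 1) := by
  have hμ := CoVaR.isProbabilityMeasure_of_hasLaw (hlaw 0)
  have hl : ∀ {a c : ℝ}, 0 < a → 0 < c → Tendsto
      (fun u => CoVaR.copula μ (u * a) (u * c) / u) (𝓝[>] 0) (𝓝 (b θ₀ a c)) :=
    CoVaR.tendsto_copula_div (hhom θ₀ hθ₀) hexp
  have hβ : CoVaR.IsTailDependence (b θ₀) :=
    CoVaR.isTailDependence_of_tendsto hcontX hcontY (hhom θ₀ hθ₀) hl
  have hint : ∀ θ ∈ Θ, IntegrableOn (fun w => b θ w (2 - w)) (Set.Ioo 0 2) := fun θ hθ =>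
    CoVaR.integrableOn_model hcont hθ (hhom θ hθ) (hH θ hθ)
  -- Membership in Θ is kept because continuity of the quantile in θ is known only along Θ.
  have hmain : ∀ ε > 0, CoVaR.WithHighProb P (fun n ω => θhat n ω ∈ Θ ∧ ‖θhat n ω - θ₀‖ < ε) := by
    intro ε hε
    obtain ⟨c, hc, hcε⟩ := hident ε hε
    refine ((CoVaR.WithHighProb.of_ae hθhat).and (CoVaR.withHighProb_distS1 hlaw hindep hcontX
      hcontY hk hkn hβ hl (half_pos hc))).mono (Eventually.of_forall fun n ω hω => ?_)
    obtain ⟨⟨hmem, hmin⟩, hd⟩ := hω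
    refine ⟨hmem, ?_⟩
    -- Far from θ₀, identifiability would give c ≤ distance from fitted model to truth ≤ twice the
    -- empirical error < c.
    by_contra! hge
    have h1 := CoVaR.distS1_triangle (hint _ hmem) (CoVaR.integrableOn_empiricalTailDep
      (fun i => X i ω) (fun i => Y i ω) n (k n / n)) (hint _ hθ₀)
    have h2 := hmin hθ₀
    simp only [Set.mem_ofPred_eq] at h2
    linarith [hcε _ hmem hge]
  refine ⟨CoVaR.tendstoInMeasure_iff_withHighProb.2 fun ε hε =>
    (hmain ε hε).mono (Eventually.of_forall fun n ω hω => hω.2), fun q hq => ?_⟩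
  refine CoVaR.tendstoInMeasure_iff_withHighProb.2 fun ε hε => ?_
  set r₀ := CoVaR.quantileInv (fun r => b θ₀ 1 r) q with hr₀
  have hr₀pos : 0 < r₀ := hβ.quantileInv_pos (hH θ₀ hθ₀) hq
  have hquant : Tendsto (fun θ => CoVaR.quantileInv (fun r => b θ 1 r) q) (𝓝[Θ] θ₀) (𝓝 r₀) :=
    hβ.tendsto_quantileInv (hH θ₀ hθ₀) (eventually_mem_nhdsWithin.mono hH)
      (fun r hr => CoVaR.tendsto_model hcont hhom hθ₀ one_pos hr) hq
  have hadj : Tendsto (fun n : ℕ => CoVaR.adjustedLevel (CoVaR.copula μ) q (k n / n) / (k n / n))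
      atTop (𝓝 r₀) :=
    (CoVaR.tendsto_adjustedLevel_div hβ (hH θ₀ hθ₀) hl hq).comp
      (CoVaR.tendsto_div_nhdsGT_zero hk hkn)
  -- Treating n and θ as independent variables makes the limit deterministic; the estimator is
  -- substituted only at the end, on the event that it lies in Θ near θ₀.
  have hratio : Tendsto (fun x : ℕ × EuclideanSpace ℝ (Fin d) =>
      CoVaR.quantileInv (fun r => b x.2 1 r) q /
        (CoVaR.adjustedLevel (CoVaR.copula μ) q (k x.1 / x.1) / (k x.1 / x.1)))
      (atTop ×ˢ 𝓝[Θ] θ₀) (𝓝 1) := by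
    have := (hquant.comp tendsto_snd).div (hadj.comp tendsto_fst) hr₀pos.ne'
    rwa [div_self hr₀pos.ne'] at this
  obtain ⟨A, hA, B, hB, hAB⟩ :=
    eventually_prod_iff.1 ((Metric.tendsto_nhds.1 hratio) ε hε)
  obtain ⟨δ, hδ, hδB⟩ := Metric.mem_nhdsWithin_iff.1 hB
  refine (hmain δ hδ).mono ?_
  filter_upwards [hA] with n hn ω hω
  have hBω : B (θhat n ω) := hδB ⟨by rw [Metric.mem_ball, dist_eq_norm]; exact hω.2, hω.1⟩
  have h := hAB hn hBω
  rw [Real.dist_eq, div_div_eq_mul_div] at h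
  exact h
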